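/- Let $\mathbb F$ be a finite field of order $q=3^m$, $m\ge 2$, let $\mathrm{Tr}(x)=x+x^3+\dots+x^{3^{m-1}}$ be the absolute trace, and let $a\in\mathbb F^*$. Let $\omega=e^{2\pi i/3}$ and let $K(a)=\sum_{x\in\mathbb F}\omega^{\mathrm{Tr}(x+a/x)}$, where $a/x$ is read as $0$ for $x=0$, be the Kloosterman sum; when $K(a)=0$, it is by convention regarded as divisible by $3^m$ but not by $3^{m+1}$. For $c\in\mathbb F$ write $c^{1/3}$ for its unique cube root in $\mathbb F$. A $3$-division tower for $a$ is a sequence $x_0,x_1,\dots$ in $\mathbb F$ with $x_0=a^{1/3}$ and $$x_i^3-x_{i-1}^{1/3}x_i^2+(a(1-x_{i-1}))^{1/3}x_i-(a^2(a+x_{i-1}))^{1/3}=0\qquad(i\ge 1).$$ Then $\mathrm{Tr}(a)=0$ if and only if $a=z^{27}-z^9$ for some $z\in\mathbb F$. Suppose that $\mathrm{Tr}(a)=0$. For every $z\in\mathbb F$ with $a=z^{27}-z^9$, the elements $$x_0=z^9-z^3,\qquad x_1=(z^4-1)(z^3-1)z^2$$ form a $3$-division tower for $a$, and every $3$-division tower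 $(x_0,x_1)$ for $a$ is of this form for some such $z$. Moreover, there is such a $z$ with $z^2\ne-1$, and for every such $z$ with $z^2\neq -1$, the sum $K(a)$ is divisible by $27$ if and only if $$\mathrm{Tr}\left(\frac{z^5(z-1)(z+1)^7}{(z^2+1)^3}\right)=0 .$$ -/

import Mathlib

/-- The absolute trace `Tr(x) = x + x^3 + ⋯ + x^(3^(m-1))` of the field `F` with `3^m` elements,
as an element of the prime field. -/
noncomputable def absTrace {F : Type*} [Field F] [Algebra (ZMod 3) F] (x : F) : ZMod 3 :=
  Algebra.trace (ZMod 3) F x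

/-- The ternary Kloosterman sum `K(a) = ∑_{x ∈ F} ω^Tr(x + a/x)` with `ω = exp(2πi/3)`.
The sum includes `x = 0`, where `a/x` is read as `0`. -/
noncomputable def kloosterman {F : Type*} [Field F] [Fintype F] [Algebra (ZMod 3) F] (a : F) : ℂ :=
  ∑ x : F, Complex.exp (2 * Real.pi * Complex.I / 3) ^ (absTrace (x + a / x)).val

/-- `3^t` divides the Kloosterman sum `K(a)`: the sum is an integer multiple of `3^t`, with the
convention that a vanishing sum over the field of order `q = 3^m` is divisible by `3^m` but not by
`3^(m+1)`, that is, only by those powers of `3` that divide `q`. -/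
def PowThreeDvdKloosterman {F : Type*} [Field F] [Fintype F] [Algebra (ZMod 3) F]
    (t : ℕ) (a : F) : Prop :=
  (∃ n : ℤ, kloosterman a = (3 : ℂ) ^ t * (n : ℂ)) ∧
    (kloosterman a = 0 → 3 ^ t ∣ Fintype.card F)

/-- The unique cube root `x^(1/3)` in a finite field of characteristic `3`. -/
noncomputable def cubeRoot {F : Type*} [Field F] [Finite F] [CharP F 3] (x : F) : F :=
  (frobeniusEquiv F 3).symm x

/-- The equation satisfied by the abscissa `x` of a point `P` of the elliptic curve
`y² = x³ + x² - a` such that `3 P` has abscissa `ξ`. -/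
def ThreeDivisionEq {F : Type*} [Field F] [Finite F] [CharP F 3] (a ξ x : F) : Prop :=
  x ^ 3 - cubeRoot ξ * x ^ 2 + cubeRoot (a * (1 - ξ)) * x - cubeRoot (a ^ 2 * (a + ξ)) = 0

/-- A `3`-division tower `x_0, …, x_n` for `a`: it starts with `x_0 = a^(1/3)`, and each `x_(i+1)`
is a solution of the `3`-division equation with `ξ = x_i`. -/
def IsThreeDivisionTower {F : Type*} [Field F] [Finite F] [CharP F 3] (a : F) {n : ℕ}
    (x : Fin (n + 1) → F) : Prop :=
  x 0 = cubeRoot a ∧ ∀ i : Fin n, ThreeDivisionEq a (x i.castSucc) (x i.succ)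

/-!
The proof runs through the elliptic curve `E : y² = x³ + x² - a` over the field of `q` elements.

Counting solutions of `t³ - t = x + a / x` in two ways and manipulating quadratic character sums
gives `K(a) = #E - q` (`kloosterman_eq_card_sub`). Hence `27 ∣ K(a)` is the same as `27 ∣ #E` when
`27 ∣ q`; for `q ≤ 9` neither holds, since `|K(a)| < 27`, `0 < #E < 27`, and a vanishing sum does not
count as divisible by `27` (`powThreeDvdKloosterman_three_iff`).

The curve is ordinary with exactly three points of order dividing `3`, namely the point at infinity
and those with `x³ = a`, so the `3`-primary part of `E` is cyclic. As soon as a point `P` of order `9`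
is known, `27 ∣ #E` means that `P = 3 Q` for some point `Q`
(`twentySeven_dvd_card_iff_exists_cube_root`). Multiplication by `3` is Frobenius followed by a
separable isogeny of degree `3`, and dividing a point `(ξ, η)` by that isogeny amounts to solving the
Artin–Schreier equation `w³ - w = η`. Thus `(ξ, η)` is divisible by `3` if and only if `Tr(η) = 0`
(`kloostermanCurve.exists_three_nsmul_eq_iff`).

If `Tr(a) = 0` then `a = z²⁷ - z⁹`, and the point with abscissa `(z⁴ - 1)(z³ - 1)z²` and ordinate
`z²(z³ - 1)(z² - 1)` has order `9`. The trace of its ordinate agrees with that of the given rational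
function of `z`, because their difference is `g³ - g` for `g = 1 / (z² + 1)`. The statement on towers
holds because the three solutions of the division equation belong to the three solutions `z`, `z + 1`
and `z - 1` of `a = z²⁷ - z⁹`, which share the same `x₀`.
-/

/-! ### The trace and Artin–Schreier equations -/

section ArtinSchreier

variable {F : Type*} [Field F]

theorem absTrace_add [Algebra (ZMod 3) F] (x y : F) : absTrace (x + y) = absTrace x + absTrace y :=
  map_add _ _ _

theorem absTrace_neg [Algebra (ZMod 3) F] (x : F) : absTrace (-x) = -absTrace x :=
  map_neg _ _

theorem absTrace_cube_sub_self [Finite F] [Algebra (ZMod 3) F] (w : F) : absTrace (w ^ 3 - w) = 0 := by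
  have h := Algebra.trace_eq_of_algEquiv (FiniteField.frobeniusAlgEquivOfAlgebraic (ZMod 3) F) w
  have h' : FiniteField.frobeniusAlgEquivOfAlgebraic (ZMod 3) F w = w ^ 3 := by
    simp [ZMod.card]
  rw [h'] at h
  simp only [absTrace, map_sub, h, sub_self]

theorem cube_sub_self_eq_zero_iff [CharP F 3] {w : F} : w ^ 3 - w = 0 ↔ w = 0 ∨ w = 1 ∨ w = -1 := by
  constructor
  · intro h
    have h' : w * ((w - 1) * (w + 1)) = 0 := by linear_combination h
    rcases mul_eq_zero.1 h' with h | h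
    · exact .inl h
    · rcases mul_eq_zero.1 h with h | h
      · exact .inr (.inl (sub_eq_zero.1 h))
      · exact .inr (.inr (eq_neg_of_add_eq_zero_left h))
  · rintro (rfl | rfl | rfl) <;> ring

/-- Additive Hilbert 90 over `𝔽₃`. The image of `w ↦ w³ - w` lies in the kernel of the trace, and
both have codimension one: the kernel of `w ↦ w³ - w` is the prime field. -/
theorem absTrace_eq_zero_iff [Finite F] [CharP F 3] [Algebra (ZMod 3) F] (x : F) :
    absTrace x = 0 ↔ ∃ w : F, w ^ 3 - w = x := by
  let φ : F →ₗ[ZMod 3] F :=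
    (FiniteField.frobeniusAlgEquivOfAlgebraic (ZMod 3) F).toLinearMap - LinearMap.id
  have hφ (w : F) : φ w = w ^ 3 - w := by
    simp [φ, ZMod.card]
  have hle : LinearMap.range φ ≤ LinearMap.ker (Algebra.trace (ZMod 3) F) := by
    rintro _ ⟨w, rfl⟩
    rw [LinearMap.mem_ker, hφ]
    exact absTrace_cube_sub_self w
  have hker : LinearMap.ker φ ≤ Submodule.span (ZMod 3) {(1 : F)} := by
    intro w hw
    rw [LinearMap.mem_ker, hφ, cube_sub_self_eq_zero_iff] at hw
    rcases hw with rfl | rfl | rfl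
    · exact zero_mem _
    · exact Submodule.mem_span_singleton_self _
    · exact neg_mem (Submodule.mem_span_singleton_self _)
  have h1 : Module.finrank (ZMod 3) (LinearMap.ker φ) ≤ 1 :=
    (Submodule.finrank_mono hker).trans_eq (finrank_span_singleton one_ne_zero)
  have h2 := φ.finrank_range_add_finrank_ker
  have h3 := (Algebra.trace (ZMod 3) F).finrank_range_add_finrank_ker
  rw [LinearMap.range_eq_top.2 (Algebra.trace_surjective (ZMod 3) F), finrank_top,
    Module.finrank_self] at h3
  have heq := Submodule.eq_of_le_of_finrank_le hle (by omega)
  change x ∈ LinearMap.ker (Algebra.trace (ZMod 3) F) ↔ _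
  rw [← heq, LinearMap.mem_range]
  simp only [hφ]

end ArtinSchreier

/-! ### Finite abelian groups with at most three elements of order dividing `3` -/

section Cyclic

variable {G : Type*} [CommGroup G] [Finite G]

/-- Cubing maps the elements killed by `9` to those killed by `3`, with fibres of size at most `3`. -/
theorem card_pow_nine_eq_one_le (h : Nat.card {g : G // g ^ 3 = 1} ≤ 3) :
    Nat.card {g : G // g ^ 9 = 1} ≤ 9 := by
  classical
  have := Fintype.ofFinite G
  rw [Nat.card_eq_fintype_card, Fintype.card_subtype] at h ⊢
  refine (Finset.card_le_mul_card_image (f := fun g : G => g ^ 3) _ 3 ?_).trans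
    (Nat.mul_le_mul_left 3 (le_trans (Finset.card_le_card ?_) h))
  · intro b hb
    obtain ⟨c, -, rfl⟩ := Finset.mem_image.1 hb
    refine le_trans (Finset.card_le_card_of_injOn (fun x => x / c) ?_ ?_) h
    · intro x hx
      simp only [Finset.coe_filter, Finset.mem_filter, Finset.mem_univ, true_and,
        Set.mem_ofPred_eq] at hx ⊢
      rw [div_pow, hx.2, div_self']
    · intro x _ y _ hxy
      exact div_left_injective hxy
  · intro b hb
    obtain ⟨c, hc, rfl⟩ := Finset.mem_image.1 hb
    simp only [Finset.mem_filter, Finset.mem_univ, true_and] at hc ⊢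
    rw [← pow_mul, hc]

/-- If at most three elements satisfy `g ^ 3 = 1`, the `3`-primary part of the group is cyclic. An
element `p` of order `9` is then a cube exactly when that part has order at least `27`. -/
theorem twentySeven_dvd_card_iff_exists_cube_root (h : Nat.card {g : G // g ^ 3 = 1} ≤ 3) {p : G}
    (hp : p ^ 9 = 1) (hp' : p ^ 3 ≠ 1) : 27 ∣ Nat.card G ↔ ∃ g : G, g ^ 3 = p := by
  have h9 := card_pow_nine_eq_one_le h
  constructor
  · intro hd
    have : Fact (Nat.Prime 3) := ⟨Nat.prime_three⟩
    obtain ⟨K, hK⟩ := Sylow.exists_subgroup_card_pow_prime (G := G) 3 (n := 3) (by simpa using hd)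
    have hex : ∃ g ∈ K, g ^ 9 ≠ 1 := by
      by_contra! hall
      have := Nat.card_le_card_of_injective
        (fun k : K => (⟨k.1, hall k.1 k.2⟩ : {g : G // g ^ 9 = 1}))
        (fun x y hxy => Subtype.ext (congrArg (fun t => t.1) hxy))
      omega
    obtain ⟨g, hg, hg9⟩ := hex
    have hg27 : g ^ 27 = 1 := by
      have := pow_card_eq_one' (x := (⟨g, hg⟩ : K))
      rw [hK] at this
      simpa [Subtype.ext_iff] using this
    have hord : orderOf (g ^ 3) = 3 ^ (1 + 1) :=
      orderOf_eq_prime_pow (by rwa [← pow_mul]) (by rwa [← pow_mul])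
    -- the powers of `g ^ 3` exhaust the elements killed by `9`
    have hsub : (Subgroup.zpowers (g ^ 3) : Set G) = {x | x ^ 9 = 1} := by
      refine Set.eq_of_subset_of_ncard_le ?_ ?_ (Set.toFinite _)
      · rintro _ ⟨k, rfl⟩
        change ((g ^ 3) ^ k) ^ 9 = 1
        rw [← zpow_natCast, zpow_comm, zpow_natCast, ← pow_mul, hg27, one_zpow]
      · have : Nat.card (Subgroup.zpowers (g ^ 3)) = 9 := by rw [Nat.card_zpowers, hord]; rfl
        exact h9.trans this.ge
    have hmem : p ∈ (Subgroup.zpowers (g ^ 3) : Set G) := hsub ▸ hp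
    obtain ⟨k, hk⟩ := hmem
    refine ⟨g ^ k, ?_⟩
    rw [← hk]
    change _ = (g ^ 3) ^ k
    rw [← zpow_natCast, zpow_comm, zpow_natCast]
  · rintro ⟨g, rfl⟩
    have : Fact (Nat.Prime 3) := ⟨Nat.prime_three⟩
    have hord : orderOf g = 3 ^ (2 + 1) :=
      orderOf_eq_prime_pow (by rwa [← pow_mul] at hp') (by rwa [← pow_mul] at hp)
    have := orderOf_dvd_natCard g
    rwa [hord] at this

end Cyclic

/-! ### The Kloosterman sum as a point count -/

section KloostermanCount

variable {F : Type*} [Field F] [Fintype F]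

theorem sum_comp_sq [DecidableEq F] (hF : ringChar F ≠ 2) (h : F → ℤ) :
    ∑ t, h (t ^ 2) = ∑ s, (quadraticChar F s + 1) * h s := by
  rw [← Finset.sum_fiberwise Finset.univ (fun t : F => t ^ 2)]
  refine Finset.sum_congr rfl fun s _ => ?_
  rw [← quadraticChar_card_sqrts hF, Finset.sum_congr rfl (g := fun _ => h s) (by
    intro t ht; rw [(Finset.mem_filter.1 ht).2]), Finset.sum_const, nsmul_eq_mul]
  congr 3
  ext t
  simp

/-- The substitution `s = -a / v` turns the quartic `s (s³ + s² + s - a)` into the cubic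
`v³ + v² - a v + a²`, up to a square. With `v = w - a` this cubic becomes `w³ + w² - a³`, the
Frobenius twist of `x³ + x² - a`. The value `v = 0` corresponds to `s = 0` and accounts for
the `- 1`. -/
theorem quadraticChar_sum_reciprocal_twist [DecidableEq F] [CharP F 3] {a : F} (ha : a ≠ 0) :
    ∑ s, quadraticChar F s * quadraticChar F (s ^ 3 + s ^ 2 + s - a) =
      ∑ x, quadraticChar F (x ^ 3 + x ^ 2 - a) - 1 := by
  have h1 : ∑ x, quadraticChar F (x ^ 3 + x ^ 2 - a) =
      ∑ v, quadraticChar F (v ^ 3 + v ^ 2 - a * v + a ^ 2) := by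
    calc _ = ∑ x, quadraticChar F ((x ^ 3) ^ 3 + (x ^ 3) ^ 2 - a ^ 3) := by
          refine Finset.sum_congr rfl fun x _ => ?_
          have : (x ^ 3) ^ 3 + (x ^ 3) ^ 2 - a ^ 3 = (x ^ 3 + x ^ 2 - a) ^ 3 := by grind
          rw [this, map_pow]
          rcases (quadraticChar_isQuadratic F) (x ^ 3 + x ^ 2 - a) with h | h | h <;> rw [h] <;> rfl
      _ = ∑ x, quadraticChar F (x ^ 3 + x ^ 2 - a ^ 3) :=
          Function.Bijective.sum_comp (e := fun x : F => x ^ 3) (frobeniusEquiv F 3).bijective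
            fun x => quadraticChar F (x ^ 3 + x ^ 2 - a ^ 3)
      _ = ∑ v, quadraticChar F ((v + a) ^ 3 + (v + a) ^ 2 - a ^ 3) :=
          (Equiv.sum_comp (Equiv.addRight a) fun x => quadraticChar F (x ^ 3 + x ^ 2 - a ^ 3)).symm
      _ = _ := Finset.sum_congr rfl fun v _ => by congr 1; grind
  have h2 : ∀ v : F, quadraticChar F (-a / v) *
      quadraticChar F ((-a / v) ^ 3 + (-a / v) ^ 2 + (-a / v) - a) =
      quadraticChar F (v ^ 3 + v ^ 2 - a * v + a ^ 2) - if v = 0 then 1 else 0 := by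
    intro v
    split_ifs with hv
    · subst hv
      simp [quadraticChar_sq_one' ha]
    · have : (-a / v) * ((-a / v) ^ 3 + (-a / v) ^ 2 + (-a / v) - a) =
        (a / v ^ 2) ^ 2 * (v ^ 3 + v ^ 2 - a * v + a ^ 2) := by
        field_simp
        ring
      rw [← map_mul, this, map_mul, quadraticChar_sq_one' (by positivity), one_mul, sub_zero]
  let e : F ≃ F := Function.Involutive.toPerm (fun v => -a / v) fun v => by
    rcases eq_or_ne v 0 with rfl | hv
    · simp
    · field_simp
  rw [h1, ← Equiv.sum_comp e]
  refine (Finset.sum_congr rfl fun v _ => h2 v).trans ?_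
  rw [Finset.sum_sub_distrib]
  simp

/-- In `s = t²`, the sextic is the cubic `s³ + s² + s - a`, which is `x³ + x² - a` for `s = x + 1`.
The sum over `t` is the sum over `s` weighted by `1 + χ(s)`, and both parts are known. -/
theorem quadraticChar_sum_even_sextic [DecidableEq F] [CharP F 3] {a : F} (ha : a ≠ 0) :
    ∑ t, quadraticChar F ((t ^ 3 - t) ^ 2 - a) =
      2 * ∑ x, quadraticChar F (x ^ 3 + x ^ 2 - a) - 1 := by
  have hF : ringChar F ≠ 2 := by rw [ringChar.eq F 3]; decide
  have h1 : ∑ s, quadraticChar F (s ^ 3 + s ^ 2 + s - a) =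
      ∑ x, quadraticChar F (x ^ 3 + x ^ 2 - a) := by
    rw [← Equiv.sum_comp (Equiv.addRight (1 : F))]
    refine Finset.sum_congr rfl fun x _ => ?_
    rw [Equiv.coe_addRight]
    congr 1
    grind
  calc _ = ∑ t, quadraticChar F ((t ^ 2) ^ 3 + (t ^ 2) ^ 2 + t ^ 2 - a) :=
        Finset.sum_congr rfl fun t _ => by congr 1; grind
    _ = _ := by
        rw [sum_comp_sq hF (fun s => quadraticChar F (s ^ 3 + s ^ 2 + s - a))]
        simp only [add_mul, one_mul, Finset.sum_add_distrib]
        rw [quadraticChar_sum_reciprocal_twist ha, h1]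
        ring

theorem card_sq_eq [DecidableEq F] (hF : ringChar F ≠ 2) (f : F → F) :
    (Nat.card {p : F × F // p.2 ^ 2 = f p.1} : ℤ) =
      ∑ x, quadraticChar F (f x) + Fintype.card F := by
  rw [Nat.card_congr (Equiv.subtypeProdEquivSigmaSubtype fun x y : F => y ^ 2 = f x),
    Nat.card_sigma]
  push_cast
  have (x : F) : (Nat.card {y : F // y ^ 2 = f x} : ℤ) = quadraticChar F (f x) + 1 := by
    rw [← quadraticChar_card_sqrts hF, Nat.card_eq_fintype_card, Fintype.card_subtype]
    congr 2
    ext t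
    simp
  simp only [this, Finset.sum_add_distrib, Finset.sum_const, Finset.card_univ, nsmul_eq_mul,
    mul_one]

theorem card_artinSchreier_fiber [CharP F 3] [Algebra (ZMod 3) F] (c : F) :
    Nat.card {t : F // t ^ 3 - t = c} = if absTrace c = 0 then 3 else 0 := by
  split_ifs with h
  · obtain ⟨w, rfl⟩ := (absTrace_eq_zero_iff c).1 h
    classical
    have hset : ∀ t : F, t ^ 3 - t = w ^ 3 - w ↔ t ∈ ({w, w + 1, w - 1} : Finset F) := by
      intro t
      rw [← sub_eq_zero, show t ^ 3 - t - (w ^ 3 - w) = (t - w) ^ 3 - (t - w) by grind,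
        cube_sub_self_eq_zero_iff, Finset.mem_insert, Finset.mem_insert, Finset.mem_singleton]
      grind
    rw [Nat.card_congr (Equiv.subtypeEquivRight hset), Nat.card_eq_fintype_card, Fintype.card_coe]
    have h1 : (1 : F) ≠ 0 := one_ne_zero
    rw [Finset.card_eq_three]
    exact ⟨w, w + 1, w - 1, by grind, by grind, by grind, rfl⟩
  · have : IsEmpty {t : F // t ^ 3 - t = c} :=
      ⟨fun t => h ((absTrace_eq_zero_iff c).2 ⟨t.1, t.2⟩)⟩
    exact Nat.card_of_isEmpty

/-- Three times the left-hand count is the number of points on `t³ - t = x + a / x`. For `x ≠ 0`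
this is a quadratic equation in `x` with discriminant `(t³ - t)² - a`; the value `x = 0`, where
`a / x` is `0`, adds the three roots of `t³ = t`. -/
theorem three_mul_card_absTrace_eq_zero [DecidableEq F] [CharP F 3] [Algebra (ZMod 3) F]
    {a : F} (ha : a ≠ 0) :
    3 * (Nat.card {x : F // absTrace (x + a / x) = 0} : ℤ) =
      2 * ∑ x, quadraticChar F (x ^ 3 + x ^ 2 - a) + Fintype.card F + 2 := by
  have hF : ringChar F ≠ 2 := by rw [ringChar.eq F 3]; decide
  have hl : 3 * (Nat.card {x : F // absTrace (x + a / x) = 0} : ℤ) =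
      Nat.card {p : F × F // p.2 ^ 3 - p.2 = p.1 + a / p.1} := by
    rw [Nat.card_congr (Equiv.subtypeProdEquivSigmaSubtype fun x t : F => t ^ 3 - t = x + a / x),
      Nat.card_sigma]
    simp only [card_artinSchreier_fiber]
    rw [← Finset.sum_filter, Finset.sum_const, Nat.card_eq_fintype_card, Fintype.card_subtype,
      smul_eq_mul]
    push_cast
    exact mul_comm _ _
  -- the points with `x = 0` are split off; the others lie on the quadratic `x² - (t³ - t) x + a = 0`
  have e : {p : F × F // p.2 ^ 3 - p.2 = p.1 + a / p.1} ≃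
      {t : F // t ^ 3 - t = 0} ⊕ {p : F × F // p.2 ^ 2 = (p.1 ^ 3 - p.1) ^ 2 - a} :=
    { toFun := fun p => if h : p.1.1 = 0 then .inl ⟨p.1.2, by rw [p.2, h]; simp⟩
        else .inr ⟨(p.1.2, -p.1.1 - (p.1.2 ^ 3 - p.1.2)), by
          have := p.2
          field_simp at this
          grind⟩
      invFun := Sum.elim (fun t => ⟨(0, t.1), by simp [t.2]⟩)
        (fun p => ⟨(-p.1.2 - (p.1.1 ^ 3 - p.1.1), p.1.1), by
          have h := p.2
          have hne : -p.1.2 - (p.1.1 ^ 3 - p.1.1) ≠ 0 := by grind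
          simp only
          field_simp
          grind⟩)
      left_inv := by
        rintro ⟨⟨x, t⟩, h⟩
        by_cases hx : x = 0
        · simp [hx]
        · simp [hx]
      right_inv := by
        rintro (⟨t, h⟩ | ⟨⟨t, y⟩, h⟩)
        · simp
        · have hne : -y - (t ^ 3 - t) ≠ 0 := by simp only at h; grind
          simp [hne] }
  rw [hl, Nat.card_congr e, Nat.card_sum, card_artinSchreier_fiber, if_pos (by simp [absTrace])]
  push_cast
  rw [card_sq_eq hF (fun t => (t ^ 3 - t) ^ 2 - a), quadraticChar_sum_even_sextic ha]
  ring

/-- Pairing `x` with `-x` replaces each summand by `ω^c + ω^(-c)`, which is `2` if `c = 0` and `-1`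
otherwise. -/
theorem two_mul_kloosterman [Algebra (ZMod 3) F] (a : F) :
    2 * kloosterman a =
      3 * (Nat.card {x : F // absTrace (x + a / x) = 0} : ℂ) - Fintype.card F := by
  set ω : ℂ := Complex.exp (2 * Real.pi * Complex.I / 3) with hω
  have hprim : IsPrimitiveRoot ω 3 := Complex.isPrimitiveRoot_exp 3 (by norm_num)
  have hsum : 1 + ω + ω ^ 2 = 0 := by
    simpa [Finset.sum_range_succ] using hprim.geom_sum_eq_zero (by norm_num)
  have hpt : ∀ c : ZMod 3, ω ^ c.val + ω ^ (-c).val = if c = 0 then 2 else -1 := by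
    have h1 : (-1 : ZMod 3).val = 2 := rfl
    have h2 : (-2 : ZMod 3).val = 1 := rfl
    have h3 : (2 : ZMod 3).val = 2 := rfl
    have h4 : (1 : ZMod 3).val = 1 := rfl
    intro c
    fin_cases c
    · change ω ^ 0 + ω ^ 0 = if (0 : ZMod 3) = 0 then 2 else -1
      norm_num
    · change ω ^ (1 : ZMod 3).val + ω ^ (-1 : ZMod 3).val = if (1 : ZMod 3) = 0 then 2 else -1
      rw [h1, h4, if_neg (by decide)]
      linear_combination hsum
    · change ω ^ (2 : ZMod 3).val + ω ^ (-2 : ZMod 3).val = if (2 : ZMod 3) = 0 then 2 else -1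
      rw [h2, h3, if_neg (by decide)]
      linear_combination hsum
  have hneg : kloosterman a = ∑ x : F, ω ^ (-absTrace (x + a / x)).val := by
    rw [kloosterman, ← Equiv.sum_comp (Equiv.neg F)]
    refine Finset.sum_congr rfl fun x _ => ?_
    rw [← absTrace_neg, Equiv.neg_apply, div_neg, neg_add]
  rw [two_mul]
  nth_rw 2 [hneg]
  rw [kloosterman, ← Finset.sum_add_distrib]
  simp only [← hω, hpt]
  have (x : F) : (if absTrace (x + a / x) = 0 then (2 : ℂ) else -1) =
      3 * (if absTrace (x + a / x) = 0 then 1 else 0) - 1 := by split_ifs <;> norm_num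
  simp only [this, Finset.sum_sub_distrib, ← Finset.mul_sum, Finset.sum_boole]
  rw [Nat.card_eq_fintype_card, Fintype.card_subtype]
  simp

/-- `K(a)` is the number of points on `y² = x³ + x² - a`, including the point at infinity,
minus `q`. -/
theorem kloosterman_eq_card_sub [DecidableEq F] [CharP F 3] [Algebra (ZMod 3) F]
    {a : F} (ha : a ≠ 0) :
    kloosterman a =
      (((Nat.card {p : F × F // p.2 ^ 2 = p.1 ^ 3 + p.1 ^ 2 - a} : ℤ) + 1 - Fintype.card F : ℤ) :
        ℂ) := by
  have hF : ringChar F ≠ 2 := by rw [ringChar.eq F 3]; decide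
  have h1 := two_mul_kloosterman a
  have h2 := congrArg (Int.cast : ℤ → ℂ) (three_mul_card_absTrace_eq_zero ha)
  rw [card_sq_eq hF (fun x => x ^ 3 + x ^ 2 - a)]
  push_cast at h2 ⊢
  linear_combination (h1 + h2) / 2

end KloostermanCount

/-! ### Duplication and triplication on `y² = x³ + x² - a` -/

section Curve

variable {F : Type*} [Field F]

/-- The Weierstrass curve `y² = x³ + x² - a`. In characteristic `3` its discriminant is `a`, so that
it is an elliptic curve when `a ≠ 0`. -/
def kloostermanCurve (a : F) : WeierstrassCurve.Affine F :=
  ⟨0, 1, 0, 0, -a⟩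

open WeierstrassCurve.Affine

namespace kloostermanCurve

theorem equation_iff {a x y : F} :
    (kloostermanCurve a).Equation x y ↔ y ^ 2 = x ^ 3 + x ^ 2 - a := by
  rw [WeierstrassCurve.Affine.equation_iff]
  simp [kloostermanCurve, sub_eq_add_neg]

theorem nonsingular_iff [CharP F 3] {a x y : F} (ha : a ≠ 0) :
    (kloostermanCurve a).Nonsingular x y ↔ y ^ 2 = x ^ 3 + x ^ 2 - a := by
  rw [WeierstrassCurve.Affine.nonsingular_iff', equation_iff, and_iff_left_iff_imp]
  intro h
  simp only [kloostermanCurve]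
  grind

theorem negY_eq {a x y : F} : (kloostermanCurve a).negY x y = -y := by
  simp [kloostermanCurve, negY]

theorem card_point [CharP F 3] [Finite F] {a : F} (ha : a ≠ 0) :
    Nat.card (kloostermanCurve a).Point =
      Nat.card {p : F × F // p.2 ^ 2 = p.1 ^ 3 + p.1 ^ 2 - a} + 1 := by
  rw [Nat.card_congr (nonsingularPointEquiv (kloostermanCurve a))]
  refine (Finite.card_option).trans ?_
  rw [Nat.card_congr (Equiv.subtypeEquivRight fun p => nonsingular_iff ha)]

instance [Finite F] (a : F) : Finite (kloostermanCurve a).Point :=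
  .of_equiv (Option {p : F × F // (kloostermanCurve a).Nonsingular p.1 p.2})
    (nonsingularPointEquiv (kloostermanCurve a)).symm

/-- For `a = z²⁷ - z⁹`, this rational point has order `9`, see `three_nsmul_nine_torsion`. -/
theorem nonsingular_nine_torsion [CharP F 3] {a z : F} (ha : a ≠ 0) (hz : a = z ^ 27 - z ^ 9) :
    (kloostermanCurve a).Nonsingular ((z ^ 4 - 1) * (z ^ 3 - 1) * z ^ 2)
      (z ^ 2 * (z ^ 3 - 1) * (z ^ 2 - 1)) := by
  rw [nonsingular_iff ha, hz]
  grind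

variable [CharP F 3] [DecidableEq F]

/-- The tangent at a point has slope `x / y`. -/
theorem two_nsmul {a x y : F} (h : (kloostermanCurve a).Nonsingular x y) (hy : y ≠ 0) :
    ∃ h', (2 : ℕ) • Point.some x y h =
      Point.some ((x / y) ^ 2 - 1 + x) (-(x / y * ((x / y) ^ 2 - 1) + y)) h' := by
  have hy' : y ≠ (kloostermanCurve a).negY x y := by rw [negY_eq]; grind
  have hs : (kloostermanCurve a).slope x x y y = x / y := by
    rw [slope_of_Y_ne rfl hy', negY_eq]
    simp only [kloostermanCurve]
    have : y - -y ≠ 0 := by grind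
    rw [div_eq_div_iff this hy]
    grind
  have hX : (kloostermanCurve a).addX x x ((kloostermanCurve a).slope x x y y) =
      (x / y) ^ 2 - 1 + x := by
    rw [hs, addX]
    simp only [kloostermanCurve]
    grind
  have hY : (kloostermanCurve a).addY x x y ((kloostermanCurve a).slope x x y y) =
      -(x / y * ((x / y) ^ 2 - 1) + y) := by
    rw [addY, negY_eq, negAddY, hX, hs]
    ring
  have key := Point.add_self_of_Y_ne (h₁ := h) hy'
  rw [← _root_.two_nsmul] at key
  have hns := nonsingular_add h h fun hxy => hy' hxy.right
  rw [hX, hY] at hns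
  refine ⟨hns, key.trans ?_⟩
  simp only [hX, hY]

/-- A point whose abscissa is the cube root of `a` has order `3`: then `y² = x²`, so the tangent
slope is `±1` and `2 P` has the abscissa of `P`. -/
theorem three_nsmul_eq_zero {a x y : F} (ha : a ≠ 0) (h : (kloostermanCurve a).Nonsingular x y)
    (hu : x ^ 3 = a) : (3 : ℕ) • Point.some x y h = 0 := by
  have heq := (nonsingular_iff ha).1 h
  have hsq : y ^ 2 = x ^ 2 := by linear_combination heq + hu
  have hy : y ≠ 0 := by rintro rfl; grind
  obtain ⟨h', h2⟩ := two_nsmul h hy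
  have h1 : (x / y) ^ 2 = 1 := by rw [div_pow, hsq, div_self (by grind)]
  rw [succ_nsmul, h2]
  refine Point.add_of_Y_eq ?_ ?_
  · rw [h1]; ring
  · rw [h1, negY_eq]; ring

/-- The abscissa of `3 P` in terms of `x ^ 3` alone: multiplication by `3` factors through
Frobenius. -/
theorem three_nsmul_of_ne {a x y : F} (ha : a ≠ 0) (h : (kloostermanCurve a).Nonsingular x y)
    (hu : x ^ 3 ≠ a) :
    ∃ y' h', (3 : ℕ) • Point.some x y h =
      Point.some (x ^ 3 - a + a * x ^ 3 / (x ^ 3 - a) ^ 2) y' h' := by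
  have heq := (nonsingular_iff ha).1 h
  have hu' : x ^ 3 - a ≠ 0 := sub_ne_zero.2 hu
  by_cases hy : y = 0
  · have hx : x ≠ 0 := by rintro rfl; grind
    have hX : x ^ 3 - a + a * x ^ 3 / (x ^ 3 - a) ^ 2 = x := by
      have : x ^ 3 - a = -x ^ 2 := by grind
      rw [this]
      field_simp
      grind
    have h2 : (2 : ℕ) • Point.some x y h = 0 := by
      rw [_root_.two_nsmul]
      exact Point.add_self_of_Y_eq (by rw [negY_eq, hy, neg_zero])
    refine ⟨y, by rwa [hX], ?_⟩
    rw [succ_nsmul, h2, zero_add]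
    simp only [hX]
  · obtain ⟨h', h2⟩ := two_nsmul h hy
    have hx2 : (x / y) ^ 2 - 1 + x - x = -(x ^ 3 - a) / y ^ 2 := by
      field_simp
      grind
    have hne : (x / y) ^ 2 - 1 + x ≠ x := by
      rw [← sub_ne_zero, hx2]
      exact div_ne_zero (neg_ne_zero.2 hu') (pow_ne_zero 2 hy)
    have key := Point.add_of_X_ne (h₁ := h') (h₂ := h) hne
    have hX : (kloostermanCurve a).addX ((x / y) ^ 2 - 1 + x) x
        ((kloostermanCurve a).slope ((x / y) ^ 2 - 1 + x) x
          (-(x / y * ((x / y) ^ 2 - 1) + y)) y) = x ^ 3 - a + a * x ^ 3 / (x ^ 3 - a) ^ 2 := by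
      have hs : (kloostermanCurve a).slope ((x / y) ^ 2 - 1 + x) x
          (-(x / y * ((x / y) ^ 2 - 1) + y)) y = -(y ^ 4 + x * (x ^ 3 - a)) / (y * (x ^ 3 - a)) := by
        rw [slope_of_X_ne hne, hx2]
        field_simp
        grind
      rw [hs, addX]
      simp only [kloostermanCurve]
      field_simp
      grind
    have hns := nonsingular_add h' h fun hxy => hne hxy.left
    rw [hX] at hns
    refine ⟨_, hns, ?_⟩
    rw [succ_nsmul, h2, key]
    simp only [hX]

end kloostermanCurve

end Curve

/-! ### Division by `3` and the number of points modulo `27` -/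

section Division

variable {F : Type*} [Field F] [CharP F 3] [DecidableEq F]

open WeierstrassCurve.Affine

namespace kloostermanCurve

/-- `(ξ, η)` is divisible by `3` if and only if `η` has trace zero. If `3 (x, y) = (ξ, ±η)` then
`w = y³ / (x³ - a)` satisfies `w³ - w = ±η`. Conversely, given `w³ - w = η`, put
`e = w² - 1 - ξ`; the point with `x³ = a + a / e` and `y³ = a w / e` triples to `±(ξ, η)`. -/
theorem exists_three_nsmul_eq_iff [Finite F] [Algebra (ZMod 3) F] {a ξ η : F} (ha : a ≠ 0)
    (h : (kloostermanCurve a).Nonsingular ξ η) :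
    (∃ Q : (kloostermanCurve a).Point, (3 : ℕ) • Q = .some ξ η h) ↔ absTrace η = 0 := by
  have hP := (nonsingular_iff ha).1 h
  constructor
  · rintro ⟨_ | ⟨x, y, hQ⟩, h3⟩
    · exact absurd h3.symm (by rw [← Point.zero_def, nsmul_zero]; exact Point.some_ne_zero h)
    have hu : x ^ 3 ≠ a := fun hu =>
      Point.some_ne_zero h (h3.symm.trans (three_nsmul_eq_zero ha hQ hu))
    obtain ⟨y', h', h3'⟩ := three_nsmul_of_ne ha hQ hu
    have heq := (nonsingular_iff ha).1 hQ
    rw [h3', Point.some.injEq] at h3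
    have hu' : x ^ 3 - a ≠ 0 := sub_ne_zero.2 hu
    -- everything is expressed through `u` and `e = a / u`, in which the identities are polynomial
    obtain ⟨u, hu_def⟩ : ∃ u, x ^ 3 - a = u := ⟨_, rfl⟩
    obtain ⟨e, he⟩ : ∃ e, e = a / u := ⟨_, rfl⟩
    obtain ⟨w, hw⟩ : ∃ w, w = y ^ 3 / u := ⟨_, rfl⟩
    rw [hu_def] at h3 hu'
    have heu : e * u = a := by rw [he, div_mul_cancel₀ _ hu']
    have hwu : w * u = y ^ 3 := by rw [hw, div_mul_cancel₀ _ hu']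
    have hξ : ξ = u + e ^ 2 + e := by
      rw [← h3.1, he, eq_add_of_sub_eq hu_def]
      field_simp
      ring
    have hw2 : w ^ 2 = 1 + e + ξ := by
      have hx : x ^ 3 = u + e * u := by rw [heu]; linear_combination hu_def
      have h1 : (w * u) ^ 2 = (1 + e + ξ) * u ^ 2 := by
        rw [hwu, show (y ^ 3) ^ 2 = (y ^ 2) ^ 3 by ring, heq,
          show (x ^ 3 + x ^ 2 - a) ^ 3 = (x ^ 3) ^ 3 + (x ^ 3) ^ 2 - a ^ 3 by grind, hx, ← heu, hξ]
        grind
      rw [mul_pow] at h1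
      exact mul_right_cancel₀ (pow_ne_zero 2 hu') h1
    have hsq : η ^ 2 = (w ^ 3 - w) ^ 2 := by
      rw [hP, show (w ^ 3 - w) ^ 2 = w ^ 2 * (w ^ 2 - 1) ^ 2 by ring, hw2, hξ, ← heu]
      grind
    rcases sq_eq_sq_iff_eq_or_eq_neg.1 hsq with h | h
    · rw [h, absTrace_cube_sub_self]
    · rw [h, absTrace_neg, absTrace_cube_sub_self, neg_zero]
  · intro ht
    obtain ⟨w, rfl⟩ := (absTrace_eq_zero_iff η).1 ht
    obtain ⟨e, he⟩ : ∃ e, e = w ^ 2 - 1 - ξ := ⟨_, rfl⟩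
    have hcub : e ^ 3 + e ^ 2 - ξ * e + a = 0 := by
      have hξ : ξ = w ^ 2 - 1 - e := by rw [he]; ring
      rw [hξ] at hP ⊢
      grind
    have he0 : e ≠ 0 := by
      rintro rfl
      exact ha (by linear_combination hcub)
    obtain ⟨x, hx⟩ := (frobeniusEquiv F 3).surjective (a + a / e)
    obtain ⟨y, hy⟩ := (frobeniusEquiv F 3).surjective (a * w / e)
    rw [frobeniusEquiv_apply, frobenius_def] at hx hy
    have hw2 : w ^ 2 = 1 + e + ξ := by rw [he]; ring
    -- the curve equation is checked after applying Frobenius, which is injective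
    have hQ : (kloostermanCurve a).Nonsingular x y := by
      rw [nonsingular_iff ha]
      apply frobenius_inj F 3
      rw [frobenius_def, frobenius_def, show (y ^ 2) ^ 3 = (y ^ 3) ^ 2 by ring,
        show (x ^ 3 + x ^ 2 - a) ^ 3 = (x ^ 3) ^ 3 + (x ^ 3) ^ 2 - a ^ 3 by grind, hx, hy,
        div_pow, mul_pow, hw2]
      field_simp
      grind
    have hu : x ^ 3 ≠ a := by
      rw [hx, Ne, add_eq_left]
      exact div_ne_zero ha he0
    obtain ⟨y', h', h3⟩ := three_nsmul_of_ne ha hQ hu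
    have hX : x ^ 3 - a + a * x ^ 3 / (x ^ 3 - a) ^ 2 = ξ := by
      rw [hx]
      have : a + a / e - a = a / e := by ring
      rw [this]
      field_simp
      grind
    rcases Point.X_eq_iff.1 hX with h4 | h4
    · exact ⟨_, h3.trans h4⟩
    · refine ⟨-Point.some x y hQ, ?_⟩
      rw [neg_nsmul, h3, h4]
      exact neg_neg _

theorem card_three_torsion_le [Finite F] {a : F} (ha : a ≠ 0) :
    Nat.card {P : (kloostermanCurve a).Point // (3 : ℕ) • P = 0} ≤ 3 := by
  obtain ⟨b, hb⟩ := (frobeniusEquiv F 3).surjective a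
  rw [frobeniusEquiv_apply, frobenius_def] at hb
  have hP0 : (kloostermanCurve a).Nonsingular b b := by
    rw [nonsingular_iff ha]
    linear_combination -hb
  have hsub : {P : (kloostermanCurve a).Point | (3 : ℕ) • P = 0} ⊆
      {0, .some b b hP0, -.some b b hP0} := by
    rintro (_ | ⟨x, y, h⟩) h3
    · exact .inl rfl
    · have hx : x ^ 3 = a := by
        by_contra hu
        obtain ⟨y', h', h3'⟩ := three_nsmul_of_ne ha h hu
        exact Point.some_ne_zero h' (h3'.symm.trans h3)
      exact .inr (Point.X_eq_iff.1 (frobenius_inj F 3 (hx.trans hb.symm)))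
  refine (Set.ncard_le_ncard hsub (Set.toFinite _)).trans ?_
  refine (Set.ncard_insert_le _ _).trans (Nat.succ_le_succ ?_)
  exact (Set.ncard_insert_le _ _).trans (by rw [Set.ncard_singleton])

/-- Three times the point is a point with abscissa `z⁹ - z³`, the cube root of `a`. That point has
order `3`, hence the given one has order `9`. -/
theorem three_nsmul_nine_torsion {a z : F} (ha : a ≠ 0) (hz : a = z ^ 27 - z ^ 9) :
    ∃ y h, (3 : ℕ) • Point.some _ _ (nonsingular_nine_torsion ha hz) =
      Point.some (z ^ 9 - z ^ 3) y h := by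
  -- only cubes of the coordinates enter, so `v = z ^ 3` keeps the degrees small
  obtain ⟨v, hv⟩ : ∃ v, v = z ^ 3 := ⟨_, rfl⟩
  have hav : a = v ^ 3 * (v - 1) ^ 3 * (v + 1) ^ 3 := by
    rw [hz, hv]
    grind
  have hX : ((z ^ 4 - 1) * (z ^ 3 - 1) * z ^ 2) ^ 3 = (v ^ 4 - 1) * (v - 1) ^ 3 * v ^ 2 := by
    rw [hv]
    grind
  have hu : (v ^ 4 - 1) * (v - 1) ^ 3 * v ^ 2 - a = -(v ^ 2 * (v - 1) ^ 3 * (v + 1)) := by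
    rw [hav]
    grind
  have hne : v ≠ 0 ∧ v - 1 ≠ 0 ∧ v + 1 ≠ 0 := by
    refine ⟨?_, ?_, ?_⟩ <;> intro h0 <;> exact ha (by rw [hav, h0]; ring)
  obtain ⟨hv0, hv1, hv2⟩ := hne
  obtain ⟨y', h', h3⟩ := three_nsmul_of_ne ha (nonsingular_nine_torsion ha hz) (by
    rw [hX, ← sub_ne_zero, hu]
    exact neg_ne_zero.2 (by simp [hv0, hv1, hv2]))
  have hx : v ^ 3 - v = -(v ^ 2 * (v - 1) ^ 3 * (v + 1)) +
      a * ((v ^ 4 - 1) * (v - 1) ^ 3 * v ^ 2) / (-(v ^ 2 * (v - 1) ^ 3 * (v + 1))) ^ 2 := by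
    rw [hav]
    field_simp
    grind
  rw [hX, hu, ← hx] at h'
  have hb : z ^ 9 - z ^ 3 = v ^ 3 - v := by rw [hv]; ring
  refine ⟨y', by rwa [hb], h3.trans ?_⟩
  simp only [hX, hu, ← hx, hb]

theorem twentySeven_dvd_card_iff [Finite F] [Algebra (ZMod 3) F] {a z : F} (ha : a ≠ 0)
    (hz : a = z ^ 27 - z ^ 9) :
    27 ∣ Nat.card (kloostermanCurve a).Point ↔
      absTrace (z ^ 2 * (z ^ 3 - 1) * (z ^ 2 - 1)) = 0 := by
  rw [← exists_three_nsmul_eq_iff ha (nonsingular_nine_torsion ha hz)]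
  obtain ⟨y, h, h3⟩ := three_nsmul_nine_torsion ha hz
  refine twentySeven_dvd_card_iff_exists_cube_root
    (G := Multiplicative (kloostermanCurve a).Point) (card_three_torsion_le ha) ?_ ?_
  · change (3 * 3 : ℕ) • Point.some _ _ (nonsingular_nine_torsion ha hz) = 0
    rw [mul_nsmul, h3]
    exact three_nsmul_eq_zero ha h (by rw [hz]; grind)
  · change ¬ ((3 : ℕ) • Point.some _ _ (nonsingular_nine_torsion ha hz) = 0)
    rw [h3]
    exact Point.some_ne_zero h

end kloostermanCurve

/-- For `q ≥ 27` this is `K(a) = #E - q`. For `q ≤ 9` both sides are false, the left one thanks to the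
convention on vanishing sums. -/
theorem powThreeDvdKloosterman_three_iff [Fintype F] [Algebra (ZMod 3) F] {a : F} (ha : a ≠ 0) :
    PowThreeDvdKloosterman 3 a ↔ 27 ∣ Nat.card (kloostermanCurve a).Point := by
  have hK := kloosterman_eq_card_sub ha
  rw [kloostermanCurve.card_point ha]
  set N := Nat.card {p : F × F // p.2 ^ 2 = p.1 ^ 3 + p.1 ^ 2 - a} with hN
  set q := Fintype.card F with hq
  obtain ⟨m, hm⟩ : ∃ m : ℕ, q = 3 ^ m := by
    obtain ⟨n, -, h⟩ := FiniteField.card F 3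
    exact ⟨n, h⟩
  have hN2 : N ≤ 2 * q := by
    have h := card_sq_eq (by rw [ringChar.eq F 3]; decide : ringChar F ≠ 2)
      (fun x => x ^ 3 + x ^ 2 - a)
    have hs : ∑ x, quadraticChar F (x ^ 3 + x ^ 2 - a) ≤ ∑ _x : F, (1 : ℤ) :=
      Finset.sum_le_sum fun x _ => by
        rcases (quadraticChar_isQuadratic F) (x ^ 3 + x ^ 2 - a) with h | h | h <;> rw [h] <;> decide
    simp only [Finset.sum_const, Finset.card_univ, nsmul_eq_mul, mul_one] at hs
    omega
  have hdvd : (∃ n : ℤ, kloosterman a = (3 : ℂ) ^ 3 * n) ↔ (27 : ℤ) ∣ (N : ℤ) + 1 - q := by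
    rw [hK]
    refine exists_congr fun n => ?_
    rw [← Int.cast_inj (α := ℂ)]
    norm_num
  have hzero : kloosterman a = 0 ↔ (N : ℤ) + 1 - q = 0 := by rw [hK, Int.cast_eq_zero]
  rw [PowThreeDvdKloosterman, hdvd, hzero, ← hq]
  rcases le_or_gt 3 m with h | h
  · have : 27 ∣ q := by rw [hm]; exact pow_dvd_pow 3 h
    omega
  · -- for `q ≤ 9` the sum is too small to be a nonzero multiple of `27`
    have hq9 : q ≤ 9 := by rw [hm]; exact Nat.pow_le_pow_right (by norm_num) (Nat.le_of_lt_succ h)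
    have hq0 : 0 < q := Fintype.card_pos
    norm_num
    omega

end Division

/-! ### Three-division towers and the parametrization by `z` -/

section Tower

variable {F : Type*} [Field F] [CharP F 3]

theorem cubeRoot_eq_iff [Finite F] {x y : F} : cubeRoot x = y ↔ x = y ^ 3 := by
  rw [cubeRoot, RingEquiv.symm_apply_eq, frobeniusEquiv_apply, frobenius_def]

/-- The roots of the cubic are the values of `(z⁴ - 1)(z³ - 1)z²` at `z`, `z + 1` and `z - 1`. -/
theorem threeDivisionEq_iff [Finite F] {a z x : F} (hz : a = z ^ 27 - z ^ 9) :
    ThreeDivisionEq a (z ^ 9 - z ^ 3) x ↔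
      (x - (z ^ 4 - 1) * (z ^ 3 - 1) * z ^ 2) *
      (x - ((z + 1) ^ 4 - 1) * ((z + 1) ^ 3 - 1) * (z + 1) ^ 2) *
      (x - ((z - 1) ^ 4 - 1) * ((z - 1) ^ 3 - 1) * (z - 1) ^ 2) = 0 := by
  have h1 : cubeRoot (z ^ 9 - z ^ 3) = z ^ 3 - z := cubeRoot_eq_iff.2 (by grind)
  have h2 : cubeRoot (a * (1 - (z ^ 9 - z ^ 3))) = (z ^ 9 - z ^ 3) * (1 - (z ^ 3 - z)) :=
    cubeRoot_eq_iff.2 (by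
      rw [mul_pow, hz]
      congr 1 <;> grind)
  have h3 : cubeRoot (a ^ 2 * (a + (z ^ 9 - z ^ 3))) =
      (z ^ 9 - z ^ 3) ^ 2 * ((z ^ 9 - z ^ 3) + (z ^ 3 - z)) :=
    cubeRoot_eq_iff.2 (by
      have hb : a = (z ^ 9 - z ^ 3) ^ 3 := by rw [hz]; grind
      have hc : a + (z ^ 9 - z ^ 3) = ((z ^ 9 - z ^ 3) + (z ^ 3 - z)) ^ 3 := by rw [hz]; grind
      rw [hc, mul_pow, hb]
      ring)
  rw [ThreeDivisionEq, h1, h2, h3]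
  refine Eq.congr_left ?_
  grind

theorem isThreeDivisionTower_iff [Finite F] {a z : F} (hz : a = z ^ 27 - z ^ 9) {x : Fin 2 → F} :
    IsThreeDivisionTower a x ↔ x 0 = z ^ 9 - z ^ 3 ∧
      (x 1 = (z ^ 4 - 1) * (z ^ 3 - 1) * z ^ 2 ∨
        x 1 = ((z + 1) ^ 4 - 1) * ((z + 1) ^ 3 - 1) * (z + 1) ^ 2 ∨
        x 1 = ((z - 1) ^ 4 - 1) * ((z - 1) ^ 3 - 1) * (z - 1) ^ 2) := by
  have h0 : cubeRoot a = z ^ 9 - z ^ 3 := cubeRoot_eq_iff.2 (by rw [hz]; grind)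
  simp only [IsThreeDivisionTower, h0, Fin.forall_fin_one]
  refine and_congr_right fun hx => ?_
  change ThreeDivisionEq a (x 0) (x 1) ↔ _
  rw [hx, threeDivisionEq_iff hz, mul_eq_zero, mul_eq_zero, sub_eq_zero, sub_eq_zero, sub_eq_zero,
    or_assoc]

theorem absTrace_eq_zero_iff_exists_eq_sub [Finite F] [Algebra (ZMod 3) F] (a : F) :
    absTrace a = 0 ↔ ∃ z : F, a = z ^ 27 - z ^ 9 := by
  rw [absTrace_eq_zero_iff]
  constructor
  · rintro ⟨w, rfl⟩
    obtain ⟨y, rfl⟩ := (frobeniusEquiv F 3).surjective w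
    obtain ⟨z, rfl⟩ := (frobeniusEquiv F 3).surjective y
    refine ⟨z, ?_⟩
    simp only [frobeniusEquiv_apply, frobenius_def]
    ring
  · rintro ⟨z, rfl⟩
    exact ⟨z ^ 9, by ring⟩

/-- The two arguments differ by `g³ - g` with `g = 1 / (z² + 1)`. -/
theorem absTrace_nine_torsion_ordinate_eq [Finite F] [Algebra (ZMod 3) F] {z : F}
    (hz : z ^ 2 + 1 ≠ 0) :
    absTrace (z ^ 2 * (z ^ 3 - 1) * (z ^ 2 - 1)) =
      absTrace (z ^ 5 * (z - 1) * (z + 1) ^ 7 / (z ^ 2 + 1) ^ 3) := by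
  have : z ^ 2 * (z ^ 3 - 1) * (z ^ 2 - 1) = z ^ 5 * (z - 1) * (z + 1) ^ 7 / (z ^ 2 + 1) ^ 3 +
      ((1 / (z ^ 2 + 1)) ^ 3 - 1 / (z ^ 2 + 1)) := by
    field_simp
    grind
  rw [this, absTrace_add, absTrace_cube_sub_self, add_zero]

end Tower

theorem proposition1 {F : Type*} [Field F] [Fintype F] [CharP F 3] [Algebra (ZMod 3) F]
    (a : F) (ha : a ≠ 0) :
    (absTrace a = 0 ↔ ∃ z : F, a = z ^ 27 - z ^ 9) ∧
    (absTrace a = 0 →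
      (∃ z : F, a = z ^ 27 - z ^ 9 ∧ z ^ 2 + 1 ≠ 0) ∧
      (∀ z : F, a = z ^ 27 - z ^ 9 →
        IsThreeDivisionTower a ![z ^ 9 - z ^ 3, (z ^ 4 - 1) * (z ^ 3 - 1) * z ^ 2] ∧
        (z ^ 2 + 1 ≠ 0 →
          (PowThreeDvdKloosterman 3 a ↔
            absTrace (z ^ 5 * (z - 1) * (z + 1) ^ 7 / (z ^ 2 + 1) ^ 3) = 0))) ∧
      (∀ x : Fin 2 → F, IsThreeDivisionTower a x →
        ∃ z : F, a = z ^ 27 - z ^ 9 ∧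
          x = ![z ^ 9 - z ^ 3, (z ^ 4 - 1) * (z ^ 3 - 1) * z ^ 2])) := by
  classical
  refine ⟨absTrace_eq_zero_iff_exists_eq_sub a, fun ht => ?_⟩
  obtain ⟨z₀, hz₀⟩ := (absTrace_eq_zero_iff_exists_eq_sub a).1 ht
  have hshift : a = (z₀ + 1) ^ 27 - (z₀ + 1) ^ 9 ∧ a = (z₀ - 1) ^ 27 - (z₀ - 1) ^ 9 := by
    rw [hz₀]
    constructor <;> grind
  refine ⟨?_, fun z hz => ⟨(isThreeDivisionTower_iff hz).2 ⟨rfl, .inl rfl⟩, fun hz1 => ?_⟩,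
    fun x hx => ?_⟩
  -- if `z² = -1` then `(z + 1)² + 1 = 2 z + 1` vanishes only for `z = 1`, and `1² ≠ -1`
  · by_cases h : z₀ ^ 2 + 1 = 0
    · exact ⟨z₀ + 1, hshift.1, by grind⟩
    · exact ⟨z₀, hz₀, h⟩
  · rw [powThreeDvdKloosterman_three_iff ha, kloostermanCurve.twentySeven_dvd_card_iff ha hz,
      absTrace_nine_torsion_ordinate_eq hz1]
  · obtain ⟨h0, h1 | h1 | h1⟩ := (isThreeDivisionTower_iff hz₀).1 hx
    · exact ⟨z₀, hz₀, by ext i; fin_cases i; exacts [h0, h1]⟩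
    · exact ⟨z₀ + 1, hshift.1, by
        have h : z₀ ^ 9 - z₀ ^ 3 = (z₀ + 1) ^ 9 - (z₀ + 1) ^ 3 := by grind
        ext i; fin_cases i; exacts [h0.trans h, h1]⟩
    · exact ⟨z₀ - 1, hshift.2, by
        have h : z₀ ^ 9 - z₀ ^ 3 = (z₀ - 1) ^ 9 - (z₀ - 1) ^ 3 := by grind
        ext i; fin_cases i; exacts [h0.trans h, h1]⟩
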